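/- **Theorem.** Let $R$ be an associative ring with $1$. A hereditary torsion theory $\tau$ for right $R$-modules consists of a class of torsion modules and a class of torsion-free modules, each being the orthogonal of the other with respect to $\operatorname{Hom}_R$, such that submodules of torsion modules are torsion. Its Gabriel filter is $\mathcal F=\{I \text{ a right ideal of } R : R/I \text{ is torsion}\}$, and $t(M)$ denotes the largest torsion submodule of $M$. For $n\ge 0$, a *higher derivation of order $n$* on $R$ is a family $\{\delta_i\}_{i=0}^n$ of additive maps $R\to R$ such that $\delta_0=\mathrm{id}_R$ and $\delta_i(rs)=\sum_{j=0}^i\delta_j(r)\delta_{i-j}(s)$ for all $i\le n$ and $r,s\in R$. The torsion theory $\tau$ is *higher differential* if for every $n$, every higher derivation $\{\delta_i\}_{i=0}^n$ of order $n$ on $R$ and every $I\in\mathcal F$ there is $J\in\mathcal F$ such that $\delta_i(J)\subseteq I$ for all $i\le n$. The module of quotients of a right $R$-module $M$ is $M_{\mathcal F}=\varinjlim_{I\in\mathcal F}\operatorname{Hom}_R(I,M/t(M))$. For $x\in M$, the map $R\to M$, $r\mapsto xr$, induces a map $R_{\mathcal F}\to M_{\mathcal F}$; for $M=R$ these maps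 make $R_{\mathcal F}$ a left $R$-module. The torsion theory $\tau$ is *perfect* if, for every right $R$-module $M$, the canonical map $M\otimes_R R_{\mathcal F}\to M_{\mathcal F}$, which sends $x\otimes q$ to the image of $q$ under the map induced by $r\mapsto xr$, is an isomorphism. Then: 1. The Lambek torsion theory, that is, the torsion theory cogenerated by the injective envelope $E(R)$ of the right module $R$ (a module $M$ is torsion iff $\operatorname{Hom}_R(M,E(R))=0$), is higher differential. 2. The Goldie torsion theory, that is, the torsion theory whose torsion-free modules are exactly the nonsingular right $R$-modules (those in which only $0$ has an essential right annihilator), is higher differential. 3. Every perfect hereditary torsion theory for right $R$-modules is higher differential. -/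

import Mathlib

universe u

open MulOpposite
open scoped TensorProduct

/-! Right `R`-modules are modules over `Rᵐᵒᵖ`; the action `x · r` is `op r • x`.
The ring `R` is a right module over itself in this way, and its submodules are the right ideals. -/

/-- Right ideals of `R`. -/
abbrev RightIdeal (R : Type u) [Ring R] : Type u := Submodule Rᵐᵒᵖ R

/-- For `x` in a right `R`-module `M`, the homomorphism of right modules `R → M`, `r ↦ x · r`. -/
def leftMulMap (R : Type u) [Ring R] {M : Type u} [AddCommGroup M] [Module Rᵐᵒᵖ M] (x : M) :
    R →ₗ[Rᵐᵒᵖ] M where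
  toFun r := op r • x
  map_add' r s := by rw [op_add, add_smul]
  map_smul' s r := by
    induction s using MulOpposite.rec' with
    | h s => simp [mul_smul]

/-- The right annihilator `{r | x · r = 0}`. -/
def rightAnn (R : Type u) [Ring R] {M : Type u} [AddCommGroup M] [Module Rᵐᵒᵖ M] (x : M) :
    RightIdeal R :=
  LinearMap.ker (leftMulMap R x)

/-- A submodule is essential if it meets every nonzero submodule nontrivially. -/
def IsEssentialSubmodule {S : Type u} [Ring S] {M : Type u} [AddCommGroup M] [Module S M]
    (N : Submodule S M) : Prop :=
  ∀ K : Submodule S M, N ⊓ K = ⊥ → K = ⊥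

theorem IsEssentialSubmodule.mono {S : Type u} [Ring S] {M : Type u} [AddCommGroup M] [Module S M]
    {N N' : Submodule S M} (h : IsEssentialSubmodule N) (hle : N ≤ N') :
    IsEssentialSubmodule N' := fun K hK =>
  h K (le_bot_iff.mp ((inf_le_inf_right K hle).trans hK.le))

theorem IsEssentialSubmodule.comap {S : Type u} [Ring S] {M : Type u} [AddCommGroup M] [Module S M]
    {M' : Type u} [AddCommGroup M'] [Module S M'] {N : Submodule S M}
    (h : IsEssentialSubmodule N) (f : M' →ₗ[S] M) : IsEssentialSubmodule (N.comap f) := by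
  intro K hK
  have h1 : K.map f = ⊥ := by
    refine h _ (le_bot_iff.mp ?_)
    rintro _ ⟨hy, ⟨k, hk, rfl⟩⟩
    have hk' : k ∈ N.comap f ⊓ K := ⟨hy, hk⟩
    rw [hK, Submodule.mem_bot] at hk'
    simp [hk']
  refine le_bot_iff.mp (hK ▸ le_inf (fun k hk => ?_) le_rfl)
  have : f k ∈ K.map f := Submodule.mem_map_of_mem hk
  rw [h1, Submodule.mem_bot] at this
  simp [this]

/-- A right module is nonsingular if its singular submodule, the set of elements with essential
right annihilator, is zero. -/
def IsNonsingularModule (R : Type u) [Ring R] (M : Type u) [AddCommGroup M] [Module Rᵐᵒᵖ M] :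
    Prop :=
  ∀ x : M, IsEssentialSubmodule (rightAnn R x) → x = 0

/-- `ι : M → E` is an injective envelope: `E` is injective and `ι` is an essential embedding. -/
structure IsInjectiveEnvelope {S : Type u} [Ring S] {M E : Type u} [AddCommGroup M] [Module S M]
    [AddCommGroup E] [Module S E] (ι : M →ₗ[S] E) : Prop where
  injective_module : Module.Injective S E
  injective : Function.Injective ι
  essential : IsEssentialSubmodule (LinearMap.range ι)

/-- A hereditary torsion theory for right `R`-modules: a class of torsion modules and a class of
torsion-free modules, each the orthogonal of the other with respect to `Hom`, such that
submodules of torsion modules are torsion. -/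
structure HereditaryTorsionTheory (R : Type u) [Ring R] where
  IsTorsion : ∀ (M : Type u) [AddCommGroup M] [Module Rᵐᵒᵖ M], Prop
  IsTorsionFree : ∀ (M : Type u) [AddCommGroup M] [Module Rᵐᵒᵖ M], Prop
  isTorsion_iff : ∀ (M : Type u) [AddCommGroup M] [Module Rᵐᵒᵖ M],
    IsTorsion M ↔ ∀ (N : Type u) [AddCommGroup N] [Module Rᵐᵒᵖ N],
      IsTorsionFree N → ∀ f : M →ₗ[Rᵐᵒᵖ] N, f = 0
  isTorsionFree_iff : ∀ (N : Type u) [AddCommGroup N] [Module Rᵐᵒᵖ N],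
    IsTorsionFree N ↔ ∀ (M : Type u) [AddCommGroup M] [Module Rᵐᵒᵖ M],
      IsTorsion M → ∀ f : M →ₗ[Rᵐᵒᵖ] N, f = 0
  hereditary : ∀ (M : Type u) [AddCommGroup M] [Module Rᵐᵒᵖ M] (K : Submodule Rᵐᵒᵖ M),
    IsTorsion M → IsTorsion K

/-- The torsion theory cogenerated by an injective right module `E`: a module is torsion if it has
no nonzero homomorphism to `E`. -/
def HereditaryTorsionTheory.cogeneratedBy {R : Type u} [Ring R] (E : Type u) [AddCommGroup E]
    [Module Rᵐᵒᵖ E] (hE : Module.Injective Rᵐᵒᵖ E) : HereditaryTorsionTheory R where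
  IsTorsion M _ _ := ∀ f : M →ₗ[Rᵐᵒᵖ] E, f = 0
  IsTorsionFree N _ _ := ∀ (M : Type u) [AddCommGroup M] [Module Rᵐᵒᵖ M],
    (∀ f : M →ₗ[Rᵐᵒᵖ] E, f = 0) → ∀ f : M →ₗ[Rᵐᵒᵖ] N, f = 0
  isTorsion_iff M _ _ :=
    ⟨fun h _ _ _ hN f => hN M h f, fun h f => h E (fun _ _ _ hM g => hM g) f⟩
  isTorsionFree_iff _ _ _ := Iff.rfl
  hereditary M _ _ K hM f := by
    obtain ⟨g, hg⟩ := hE.out K.subtype K.injective_subtype f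
    ext x
    rw [← hg x, hM g]
    rfl

/-- The Lambek torsion theory: the torsion theory cogenerated by an injective envelope `E` of the
right module `R`. -/
def HereditaryTorsionTheory.lambek {R : Type u} [Ring R] {E : Type u} [AddCommGroup E]
    [Module Rᵐᵒᵖ E] {ι : R →ₗ[Rᵐᵒᵖ] E} (h : IsInjectiveEnvelope ι) : HereditaryTorsionTheory R :=
  .cogeneratedBy E h.injective_module

theorem rightAnn_map_le {R : Type u} [Ring R] {M N : Type u} [AddCommGroup M] [Module Rᵐᵒᵖ M]
    [AddCommGroup N] [Module Rᵐᵒᵖ N] (f : M →ₗ[Rᵐᵒᵖ] N) (x : M) :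
    rightAnn R x ≤ rightAnn R (f x) := by
  intro r hr
  have hr' : op r • x = 0 := hr
  change op r • f x = 0
  rw [← map_smul, hr', map_zero]

/-- The Goldie torsion theory: the torsion-free modules are the nonsingular modules. -/
def HereditaryTorsionTheory.goldie (R : Type u) [Ring R] : HereditaryTorsionTheory R where
  IsTorsion M _ _ := ∀ (N : Type u) [AddCommGroup N] [Module Rᵐᵒᵖ N],
    IsNonsingularModule R N → ∀ f : M →ₗ[Rᵐᵒᵖ] N, f = 0
  IsTorsionFree N _ _ := IsNonsingularModule R N
  isTorsion_iff _ _ _ := Iff.rfl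
  isTorsionFree_iff N _ _ := by
    refine ⟨fun hN M _ _ hM f => hM N hN f, fun h x hx => ?_⟩
    have h1 : (LinearMap.range (leftMulMap R x)).subtype = 0 := by
      refine h (LinearMap.range (leftMulMap R x)) (fun N' _ _ hN' f => ?_) _
      have hx1 : x ∈ LinearMap.range (leftMulMap R x) := ⟨1, by simp [leftMulMap]⟩
      have h2 : f ⟨x, hx1⟩ = 0 := by
        refine hN' _ (hx.mono fun r hr => rightAnn_map_le f ⟨x, hx1⟩ ?_)
        exact Subtype.ext hr
      ext ⟨_, r, rfl⟩
      have : (⟨leftMulMap R x r, r, rfl⟩ : LinearMap.range (leftMulMap R x))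
          = op r • ⟨x, hx1⟩ := rfl
      rw [this, map_smul, h2, smul_zero]
      rfl
    have hx1 : x ∈ LinearMap.range (leftMulMap R x) := ⟨1, by simp [leftMulMap]⟩
    exact congrArg (fun g => g ⟨x, hx1⟩) h1
  hereditary M _ _ K hM N _ _ hN f := by
    set P : Submodule Rᵐᵒᵖ M := (LinearMap.ker f).map K.subtype with hP
    -- a submodule maximal among those containing `ker f` and meeting `K` inside `ker f`
    obtain ⟨L, hPL, hL⟩ := zorn_le_nonempty₀ {L : Submodule Rᵐᵒᵖ M | L ⊓ K ≤ P} (by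
      intro c hc hchain y hy
      refine ⟨sSup c, ?_, fun z hz => le_sSup hz⟩
      rintro m ⟨hm, hmK⟩
      obtain ⟨z, hz, hmz⟩ :=
        (Submodule.mem_sSup_of_directed ⟨y, hy⟩ hchain.directedOn).mp hm
      exact hc hz ⟨hmz, hmK⟩) P (show P ⊓ K ≤ P from inf_le_left)
    have hns : IsNonsingularModule R (M ⧸ L) := by
      intro q hq
      obtain ⟨x, rfl⟩ := L.mkQ_surjective q
      by_contra hne
      have hxL : x ∉ L := fun hx => hne (by simpa using hx)
      have hnot : ¬ (L ⊔ LinearMap.range (leftMulMap R x)) ⊓ K ≤ P := by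
        intro hle
        refine hxL (hL.le_of_ge hle le_sup_left ?_)
        exact Submodule.mem_sup_right ⟨1, by simp [leftMulMap]⟩
      obtain ⟨k, ⟨hk, hkK⟩, hkP⟩ := Set.not_subset.mp hnot
      obtain ⟨l, hl, _, ⟨r, rfl⟩, rfl⟩ := Submodule.mem_sup.mp hk
      set k' : K := ⟨l + leftMulMap R x r, hkK⟩ with hk'
      refine hkP ⟨k', hN _ ((hq.comap (leftMulMap R r)).mono fun s hs => ?_), rfl⟩
      have hs' : op (r * s) • L.mkQ x = 0 := hs
      rw [← map_smul, Submodule.mkQ_apply, Submodule.Quotient.mk_eq_zero] at hs'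
      have h3 : op s • (l + leftMulMap R x r) ∈ L ⊓ K := by
        refine ⟨?_, K.smul_mem _ hkK⟩
        rw [smul_add]
        refine L.add_mem (L.smul_mem _ hl) ?_
        have : op s • leftMulMap R x r = op (r * s) • x := by
          simp [leftMulMap, mul_smul]
        rwa [this]
      obtain ⟨y, hy, hyk⟩ := hL.prop h3
      have h4 : y = op s • k' := Subtype.ext hyk
      change op s • f k' = 0
      rw [← map_smul, ← h4]
      exact hy
    have h5 : L = ⊤ := by
      rw [← Submodule.ker_mkQ L, hM _ hns L.mkQ, LinearMap.ker_zero]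
    ext k
    obtain ⟨y, hy, hyk⟩ := hL.prop (⟨h5 ▸ Submodule.mem_top, k.2⟩ : (k : M) ∈ L ⊓ K)
    rw [← Subtype.ext hyk]
    exact hy

namespace HereditaryTorsionTheory

variable {R : Type u} [Ring R] (τ : HereditaryTorsionTheory R)

/-- The Gabriel filter of `τ`: the right ideals `I` such that `R / I` is torsion. -/
def gabrielFilter : Set (RightIdeal R) := {I | τ.IsTorsion (R ⧸ I)}

/-- The torsion submodule of `M`: the largest torsion submodule. -/
def torsion (M : Type u) [AddCommGroup M] [Module Rᵐᵒᵖ M] : Submodule Rᵐᵒᵖ M :=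
  sSup {K | τ.IsTorsion K}

theorem IsTorsion.of_surjective {M N : Type u} [AddCommGroup M] [Module Rᵐᵒᵖ M] [AddCommGroup N]
    [Module Rᵐᵒᵖ N] (hM : τ.IsTorsion M) (f : M →ₗ[Rᵐᵒᵖ] N) (hf : Function.Surjective f) :
    τ.IsTorsion N := by
  rw [τ.isTorsion_iff] at hM ⊢
  intro X _ _ hX g
  ext y
  obtain ⟨x, rfl⟩ := hf y
  exact congrArg (fun h => h x) (hM X hX (g ∘ₗ f))

theorem torsion_le_comap {M N : Type u} [AddCommGroup M] [Module Rᵐᵒᵖ M] [AddCommGroup N]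
    [Module Rᵐᵒᵖ N] (f : M →ₗ[Rᵐᵒᵖ] N) : τ.torsion M ≤ (τ.torsion N).comap f := by
  refine sSup_le fun K hK => Submodule.map_le_iff_le_comap.mp (le_sSup ?_)
  exact IsTorsion.of_surjective τ hK (f.submoduleMap K) (f.submoduleMap_surjective K)

/-- The Gabriel filter, directed by reverse inclusion. -/
abbrev FilterIndex : Type u := {I : RightIdeal R // I ∈ τ.gabrielFilter}ᵒᵈ

/-- The group `Hom(I, M / t(M))`, for `I` in the Gabriel filter. -/
abbrev HomGroup (M : Type u) [AddCommGroup M] [Module Rᵐᵒᵖ M] (I : τ.FilterIndex) : Type u :=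
  (OrderDual.ofDual I).1 →ₗ[Rᵐᵒᵖ] M ⧸ τ.torsion M

/-- Restriction `Hom(I, M / t(M)) → Hom(J, M / t(M))` for `J ⊆ I`. -/
def restrict (M : Type u) [AddCommGroup M] [Module Rᵐᵒᵖ M] (I J : τ.FilterIndex) (h : I ≤ J) :
    τ.HomGroup M I →+ τ.HomGroup M J where
  toFun f := f ∘ₗ Submodule.inclusion (show (OrderDual.ofDual J).1 ≤ (OrderDual.ofDual I).1 from h)
  map_zero' := LinearMap.zero_comp _
  map_add' _ _ := LinearMap.add_comp _ _ _

open Classical in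
/-- The module of quotients `M_𝓕`, the direct limit of the groups `Hom(I, M / t(M))` over `I` in
the Gabriel filter. -/
def Quotients (M : Type u) [AddCommGroup M] [Module Rᵐᵒᵖ M] : Type u :=
  AddCommGroup.DirectLimit (τ.HomGroup M) (τ.restrict M)

noncomputable instance (M : Type u) [AddCommGroup M] [Module Rᵐᵒᵖ M] :
    AddCommGroup (τ.Quotients M) := by
  classical exact AddCommGroup.DirectLimit.addCommGroup (τ.HomGroup M) (τ.restrict M)

open Classical in
/-- The class in `M_𝓕` of a homomorphism `I → M / t(M)`. -/
noncomputable def Quotients.of (M : Type u) [AddCommGroup M] [Module Rᵐᵒᵖ M] (I : τ.FilterIndex) :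
    τ.HomGroup M I →+ τ.Quotients M :=
  AddCommGroup.DirectLimit.of (τ.HomGroup M) (τ.restrict M) I

theorem Quotients.hom_ext {M : Type u} [AddCommGroup M] [Module Rᵐᵒᵖ M] {A : Type u}
    [AddCommGroup A] {g₁ g₂ : τ.Quotients M →+ A}
    (h : ∀ I f, g₁ (Quotients.of τ M I f) = g₂ (Quotients.of τ M I f)) : g₁ = g₂ := by
  classical
  exact AddCommGroup.DirectLimit.hom_ext (G := τ.HomGroup M) (f := τ.restrict M) (P := A)
    fun I => AddMonoidHom.ext (h I)

/-- The homomorphism `Hom(I, M / t(M)) → Hom(I, N / t(N))` induced by `φ : M → N`. -/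
def homGroupMap {M N : Type u} [AddCommGroup M] [Module Rᵐᵒᵖ M] [AddCommGroup N]
    [Module Rᵐᵒᵖ N] (φ : M →ₗ[Rᵐᵒᵖ] N) (I : τ.FilterIndex) :
    τ.HomGroup M I →+ τ.HomGroup N I where
  toFun f := (Submodule.mapQ _ _ φ (τ.torsion_le_comap φ)) ∘ₗ f
  map_zero' := LinearMap.comp_zero _
  map_add' _ _ := LinearMap.comp_add _ _ _

open Classical in
/-- The functoriality `M_𝓕 → N_𝓕` of the module of quotients along `φ : M → N`: the class of
`f : I → M / t(M)` goes to the class of `I → M / t(M) → N / t(N)`. -/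
noncomputable def Quotients.map {M N : Type u} [AddCommGroup M] [Module Rᵐᵒᵖ M] [AddCommGroup N]
    [Module Rᵐᵒᵖ N] (φ : M →ₗ[Rᵐᵒᵖ] N) : τ.Quotients M →+ τ.Quotients N :=
  AddCommGroup.DirectLimit.map (G := τ.HomGroup M) (G' := τ.HomGroup N) (f := τ.restrict M)
    (f' := τ.restrict N)
    (τ.homGroupMap φ) (fun _ _ _ => rfl)

theorem Quotients.map_of {M N : Type u} [AddCommGroup M] [Module Rᵐᵒᵖ M] [AddCommGroup N]
    [Module Rᵐᵒᵖ N] (φ : M →ₗ[Rᵐᵒᵖ] N) (I : τ.FilterIndex) (f : τ.HomGroup M I) :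
    Quotients.map τ φ (Quotients.of τ M I f) =
      Quotients.of τ N I ((Submodule.mapQ _ _ φ (τ.torsion_le_comap φ)) ∘ₗ f) := by
  classical
  exact AddCommGroup.DirectLimit.map_apply_of (G := τ.HomGroup M) (G' := τ.HomGroup N)
    (f := τ.restrict M) (f' := τ.restrict N) (τ.homGroupMap φ) (fun _ _ _ => rfl) f

theorem Quotients.map_id {M : Type u} [AddCommGroup M] [Module Rᵐᵒᵖ M] :
    Quotients.map τ (LinearMap.id : M →ₗ[Rᵐᵒᵖ] M) = AddMonoidHom.id _ := by
  refine Quotients.hom_ext τ fun I f => ?_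
  rw [Quotients.map_of, Submodule.mapQ_id]
  rfl

theorem Quotients.map_comp {M N P : Type u} [AddCommGroup M] [Module Rᵐᵒᵖ M] [AddCommGroup N]
    [Module Rᵐᵒᵖ N] [AddCommGroup P] [Module Rᵐᵒᵖ P] (ψ : N →ₗ[Rᵐᵒᵖ] P) (φ : M →ₗ[Rᵐᵒᵖ] N) :
    Quotients.map τ (ψ ∘ₗ φ) = (Quotients.map τ ψ).comp (Quotients.map τ φ) := by
  refine Quotients.hom_ext τ fun I f => ?_
  rw [AddMonoidHom.comp_apply, Quotients.map_of, Quotients.map_of, Quotients.map_of]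
  congr 1
  ext x
  obtain ⟨y, hy⟩ := (τ.torsion M).mkQ_surjective (f x)
  simp [← hy]

theorem Quotients.map_add {M N : Type u} [AddCommGroup M] [Module Rᵐᵒᵖ M] [AddCommGroup N]
    [Module Rᵐᵒᵖ N] (φ ψ : M →ₗ[Rᵐᵒᵖ] N) :
    Quotients.map τ (φ + ψ) = Quotients.map τ φ + Quotients.map τ ψ := by
  refine Quotients.hom_ext τ fun I f => ?_
  rw [AddMonoidHom.add_apply, Quotients.map_of, Quotients.map_of, Quotients.map_of,
    ← AddMonoidHom.map_add]
  congr 1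
  ext x
  obtain ⟨y, hy⟩ := (τ.torsion M).mkQ_surjective (f x)
  simp [← hy]

/-- For `x : M`, the map `R_𝓕 → M_𝓕` induced by `R → M`, `r ↦ x · r`, as a function additive in
`x`. -/
noncomputable def action (M : Type u) [AddCommGroup M] [Module Rᵐᵒᵖ M] :
    M →+ τ.Quotients R →+ τ.Quotients M :=
  AddMonoidHom.mk' (fun x => Quotients.map τ (leftMulMap R x)) fun x y => by
    rw [← Quotients.map_add]
    congr 1
    ext
    simp [leftMulMap]

theorem action_smul {M : Type u} [AddCommGroup M] [Module Rᵐᵒᵖ M] (x : M) (r : R)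
    (q : τ.Quotients R) : τ.action M (op r • x) q = τ.action M x (τ.action R r q) := by
  change Quotients.map τ _ q = ((Quotients.map τ _).comp (Quotients.map τ _)) q
  rw [← Quotients.map_comp]
  congr 2
  ext
  simp [leftMulMap]

/-- The left `R`-module structure of the ring of quotients `R_𝓕`: the element `r` acts by
`R_𝓕 → R_𝓕` induced by left multiplication by `r`. -/
noncomputable instance : Module R (τ.Quotients R) where
  smul r q := τ.action R r q
  one_smul q := by
    change Quotients.map τ _ q = q
    have : leftMulMap R (1 : R) = LinearMap.id := by ext; simp [leftMulMap]
    rw [this, Quotients.map_id]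
    rfl
  mul_smul r s q := τ.action_smul r s q
  smul_zero r := map_zero (τ.action R r)
  smul_add r := map_add (τ.action R r)
  add_smul r s q := by
    change τ.action R (r + s) q = τ.action R r q + τ.action R s q
    rw [map_add, AddMonoidHom.add_apply]
  zero_smul q := by
    change τ.action R 0 q = 0
    rw [map_zero, AddMonoidHom.zero_apply]

end HereditaryTorsionTheory

/-- The subgroup of `M ⊗_ℤ N` generated by the elements `(x · r) ⊗ y - x ⊗ (r · y)`. -/
def balancedRelations (R : Type u) [Ring R] (M N : Type u) [AddCommGroup M] [Module Rᵐᵒᵖ M]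
    [AddCommGroup N] [Module R N] : Submodule ℤ (M ⊗[ℤ] N) :=
  Submodule.span ℤ {t | ∃ (x : M) (r : R) (y : N), t = (op r • x) ⊗ₜ y - x ⊗ₜ (r • y)}

/-- The tensor product `M ⊗_R N` of a right and a left module over a noncommutative ring. -/
abbrev BalancedTensor (R : Type u) [Ring R] (M N : Type u) [AddCommGroup M] [Module Rᵐᵒᵖ M]
    [AddCommGroup N] [Module R N] : Type u :=
  (M ⊗[ℤ] N) ⧸ balancedRelations R M N

namespace HereditaryTorsionTheory

variable {R : Type u} [Ring R] (τ : HereditaryTorsionTheory R)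

/-- The canonical map `M ⊗_ℤ R_𝓕 → M_𝓕`. -/
noncomputable def preCanonicalMap (M : Type u) [AddCommGroup M] [Module Rᵐᵒᵖ M] :
    M ⊗[ℤ] τ.Quotients R →ₗ[ℤ] τ.Quotients M :=
  TensorProduct.lift
    (AddMonoidHom.toIntLinearMap
      (AddMonoidHom.mk' (fun x => (τ.action M x).toIntLinearMap) fun x y => by
        ext q
        simp))

/-- The canonical map `M ⊗_R R_𝓕 → M_𝓕`; it sends `x ⊗ q` to the image of `q` under the map
`R_𝓕 → M_𝓕` induced by `r ↦ x · r`. -/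
noncomputable def canonicalMap (M : Type u) [AddCommGroup M] [Module Rᵐᵒᵖ M] :
    BalancedTensor R M (τ.Quotients R) →ₗ[ℤ] τ.Quotients M :=
  (balancedRelations R M (τ.Quotients R)).liftQ (τ.preCanonicalMap M) <| by
    refine Submodule.span_le.mpr ?_
    rintro _ ⟨x, r, q, rfl⟩
    change τ.preCanonicalMap M _ = 0
    rw [map_sub, sub_eq_zero]
    exact τ.action_smul x r q

/-- `τ` is perfect if `M ⊗_R R_𝓕 → M_𝓕` is an isomorphism for every right module `M`. (The map is
compatible with the right actions, so it is an isomorphism as soon as it is bijective.) -/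
def IsPerfect : Prop :=
  ∀ (M : Type u) [AddCommGroup M] [Module Rᵐᵒᵖ M], Function.Bijective (τ.canonicalMap M)

end HereditaryTorsionTheory

/-- `δ 0, …, δ n` is a higher derivation of order `n` on `R` (the values `δ i` with `i > n` are
irrelevant). -/
structure IsHigherDerivation {R : Type u} [Ring R] (n : ℕ) (δ : ℕ → R →+ R) : Prop where
  zero : δ 0 = AddMonoidHom.id R
  leibniz : ∀ i ≤ n, ∀ r s : R, δ i (r * s) = ∑ j ∈ Finset.range (i + 1), δ j r * δ (i - j) s

namespace HereditaryTorsionTheory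

variable {R : Type u} [Ring R] (τ : HereditaryTorsionTheory R)

/-- `τ` is higher differential of order `n`. -/
def IsHigherDifferentialOfOrder (n : ℕ) : Prop :=
  ∀ δ : ℕ → R →+ R, IsHigherDerivation n δ →
    ∀ I ∈ τ.gabrielFilter, ∃ J ∈ τ.gabrielFilter, ∀ i ≤ n, ∀ r ∈ J, δ i r ∈ I

/-- `τ` is higher differential: it is higher differential of every order. -/
def IsHigherDifferential : Prop := ∀ n : ℕ, τ.IsHigherDifferentialOfOrder n

end HereditaryTorsionTheory

/-!
Every hereditary torsion theory `τ` is higher differential; the Lambek, Goldie and perfect torsion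
theories are special cases, and no property of them beyond heredity is needed.

Let `δ` be a higher derivation of order `n` and let `I` be in the Gabriel filter. For `m ≤ n` put
`J m = {r | δ i r ∈ I for all i ≤ m}` (`IsHigherDerivation.preimage`). By the Leibniz rule `J m` is
a right ideal, and `J 0 = I`. On `J m` the Leibniz rule reads `δ (m + 1) (r * s) ≡ δ (m + 1) r * s`
modulo `I`, since every other summand has a factor `δ j r ∈ I` with `j ≤ m` on the left. So
`δ (m + 1)` induces a homomorphism of right modules `J m → R / I`
(`IsHigherDerivation.toQuotient`), whose kernel is `J (m + 1)`. Hence `J m / J (m + 1)` embeds into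
the torsion module `R / I`, and as torsion modules are closed under submodules and extensions,
`J m ∈ 𝓕` implies `J (m + 1) ∈ 𝓕` (`HereditaryTorsionTheory.mem_gabrielFilter_of_ker_le`).
-/

namespace IsHigherDerivation

variable {R : Type u} [Ring R] {n : ℕ} {δ : ℕ → R →+ R}

/-- The right ideal of all `r` such that `δ 0 r, …, δ m r` lie in the right ideal `I`. -/
def preimage (h : IsHigherDerivation n δ) (I : RightIdeal R) {m : ℕ} (hm : m ≤ n) :
    RightIdeal R where
  carrier := {r | ∀ i ≤ m, δ i r ∈ I}
  zero_mem' i _ := by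
    rw [map_zero]
    exact I.zero_mem
  add_mem' ha hb i hi := by
    rw [map_add]
    exact I.add_mem (ha i hi) (hb i hi)
  smul_mem' s r hr i hi := by
    change δ i (r * s.unop) ∈ I
    rw [h.leibniz i (hi.trans hm)]
    refine I.sum_mem fun j hj => I.smul_mem (op (δ (i - j) s.unop)) (hr j ?_)
    have := Finset.mem_range.mp hj
    omega

/-- The homomorphism of right modules `r ↦ δ (m + 1) r mod I`, defined on the right ideal where
`δ 0, …, δ m` take values in `I`. -/
def toQuotient (h : IsHigherDerivation n δ) (I : RightIdeal R) {m : ℕ} (hm : m + 1 ≤ n) :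
    h.preimage I (Nat.le_of_succ_le hm) →ₗ[Rᵐᵒᵖ] R ⧸ I where
  toFun r := I.mkQ (δ (m + 1) r)
  map_add' r s := by
    rw [Submodule.coe_add, map_add, map_add]
  map_smul' s r := by
    change I.mkQ (δ (m + 1) (r * s.unop)) = s • I.mkQ (δ (m + 1) r)
    rw [← map_smul, ← sub_eq_zero, ← map_sub, Submodule.mkQ_apply, Submodule.Quotient.mk_eq_zero,
      h.leibniz _ hm, Finset.sum_range_succ, Nat.sub_self, h.zero]
    change _ + δ (m + 1) r * s.unop - δ (m + 1) r * s.unop ∈ I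
    rw [add_sub_cancel_right]
    refine I.sum_mem fun j hj => I.smul_mem (op (δ (m + 1 - j) s.unop)) (r.2 j ?_)
    exact Nat.lt_succ_iff.mp (Finset.mem_range.mp hj)

end IsHigherDerivation

namespace HereditaryTorsionTheory

variable {R : Type u} [Ring R] (τ : HereditaryTorsionTheory R)

/-- A homomorphism to a torsion-free module vanishes if it vanishes on the kernel of some
homomorphism to a torsion module, because the image of the latter is torsion. -/
theorem eq_zero_of_ker_le {P T N : Type u} [AddCommGroup P] [Module Rᵐᵒᵖ P] [AddCommGroup T]
    [Module Rᵐᵒᵖ T] [AddCommGroup N] [Module Rᵐᵒᵖ N] (hT : τ.IsTorsion T)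
    (hN : τ.IsTorsionFree N) (φ : P →ₗ[Rᵐᵒᵖ] T) (g : P →ₗ[Rᵐᵒᵖ] N)
    (hle : LinearMap.ker φ ≤ LinearMap.ker g) : g = 0 := by
  have hrange : τ.IsTorsion (LinearMap.range φ) := τ.hereditary T _ hT
  have hzero := (τ.isTorsion_iff _).mp hrange N hN
    ((LinearMap.ker φ).liftQ g hle ∘ₗ φ.quotKerEquivRange.symm.toLinearMap)
  ext x
  simpa using LinearMap.congr_fun hzero (φ.quotKerEquivRange ((LinearMap.ker φ).mkQ x))

/-- If `P` is in the Gabriel filter, so is every right ideal that contains the kernel of a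
homomorphism from `P` to a torsion module. -/
theorem mem_gabrielFilter_of_ker_le {P K : RightIdeal R} (hP : P ∈ τ.gabrielFilter) {T : Type u}
    [AddCommGroup T] [Module Rᵐᵒᵖ T] (hT : τ.IsTorsion T) (φ : P →ₗ[Rᵐᵒᵖ] T)
    (hle : (LinearMap.ker φ).map P.subtype ≤ K) : K ∈ τ.gabrielFilter := by
  refine (τ.isTorsion_iff _).mpr fun N _ _ hN f => ?_
  have hres : (f ∘ₗ K.mkQ) ∘ₗ P.subtype = 0 := by
    refine τ.eq_zero_of_ker_le hT hN φ _ fun x hx => ?_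
    have hxK : (x : R) ∈ K := hle (Submodule.mem_map_of_mem hx)
    change f (K.mkQ x) = 0
    rw [Submodule.mkQ_apply, (Submodule.Quotient.mk_eq_zero K).mpr hxK, map_zero]
  have hPker : P ≤ LinearMap.ker (f ∘ₗ K.mkQ) := fun x hx => LinearMap.congr_fun hres ⟨x, hx⟩
  have hlift := (τ.isTorsion_iff _).mp hP N hN (P.liftQ (f ∘ₗ K.mkQ) hPker)
  refine Submodule.linearMap_qext K ?_
  rw [← P.liftQ_mkQ (f ∘ₗ K.mkQ) hPker, hlift, LinearMap.zero_comp, LinearMap.zero_comp]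

theorem preimage_mem_gabrielFilter {n : ℕ} {δ : ℕ → R →+ R} (h : IsHigherDerivation n δ)
    {I : RightIdeal R} (hI : I ∈ τ.gabrielFilter) {m : ℕ} (hm : m ≤ n) :
    h.preimage I hm ∈ τ.gabrielFilter := by
  induction m with
  | zero =>
    have hJ : h.preimage I hm = I := by
      ext r
      change (∀ i ≤ 0, δ i r ∈ I) ↔ r ∈ I
      simp [h.zero]
    rwa [hJ]
  | succ m ih =>
    refine τ.mem_gabrielFilter_of_ker_le (ih (Nat.le_of_succ_le hm)) hI (h.toQuotient I hm) ?_
    rintro _ ⟨r, hr, rfl⟩ i hi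
    rcases Nat.le_succ_iff.mp hi with hi | rfl
    · exact r.2 i hi
    · exact (Submodule.Quotient.mk_eq_zero I).mp hr

theorem isHigherDifferential : τ.IsHigherDifferential := fun _ _ h I hI =>
  ⟨h.preimage I le_rfl, τ.preimage_mem_gabrielFilter h hI le_rfl, fun i hi _ hr => hr i hi⟩

end HereditaryTorsionTheory

theorem theorem3p1 (R : Type u) [Ring R] :
    (∀ (E : Type u) [AddCommGroup E] [Module Rᵐᵒᵖ E] (ι : R →ₗ[Rᵐᵒᵖ] E)
        (h : IsInjectiveEnvelope ι),
      (HereditaryTorsionTheory.lambek h).IsHigherDifferential) ∧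
    (HereditaryTorsionTheory.goldie R).IsHigherDifferential ∧
    (∀ τ : HereditaryTorsionTheory R, τ.IsPerfect → τ.IsHigherDifferential) :=
  ⟨fun _ _ _ _ h => (HereditaryTorsionTheory.lambek h).isHigherDifferential,
    (HereditaryTorsionTheory.goldie R).isHigherDifferential,
    fun τ _ => τ.isHigherDifferential⟩
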